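/- Let $N\ge 1$ and $M,L\ge 0$ be integers and let $\lambda>0$. For a dictionary $\mathbf d=(\mathbf d_1,\dots,\mathbf d_M)$ with filters $\mathbf d_m\in\mathbb R^L$, coefficient maps $\mathbf x=(\mathbf x_1,\dots,\mathbf x_M)$ with $\mathbf x_m\in\mathbb R^N$, and a signal $\mathbf s\in\mathbb R^N$, put $$l(\mathbf d,\mathbf x;\mathbf s)=\tfrac12\Big\|\sum_{m=1}^M \mathbf d_m*\mathbf x_m-\mathbf s\Big\|_2^2+\lambda\|\mathbf x\|_1,\qquad f(\mathbf d;\mathbf s)=\min_{\mathbf x}l(\mathbf d,\mathbf x;\mathbf s),$$ where $*$ is circular convolution, $(\mathbf d_m*\mathbf x_m)_i=\sum_{j=0}^{L-1}(\mathbf d_m)_j(\mathbf x_m)_{i-j \bmod N}$. Let $\mathrm C=\{\mathbf d:\|\mathbf d_m\|_2^2\le 1\ \text{for all } m\}$ and $\|g\|_\infty=\sup_{\mathbf d\in\mathrm C}|g(\mathbf d)|$. Let $\mathbf s^{(1)},\mathbf s^{(2)},\dots$ be i.i.d. random signals whose common distribution $P$ on $\mathbb R^N$ has compact support. For $t\ge1$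 and $p\ge0$ define $$F(\mathbf d)=\mathbb E_{\mathbf s\sim P}[f(\mathbf d;\mathbf s)],\qquad F^{(t)}(\mathbf d)=\frac1t\sum_{\tau=1}^t f(\mathbf d;\mathbf s^{(\tau)}),$$ $$F^{(t)}_{\mathrm{mod}}(\mathbf d)=\frac1{\Lambda^{(t)}}\sum_{\tau=1}^t(\tau/t)^p f(\mathbf d;\mathbf s^{(\tau)}),\qquad \Lambda^{(t)}=\sum_{\tau=1}^t(\tau/t)^p.$$ Then $f(\mathbf d;\cdot)$ is $P$-integrable for every $\mathbf d\in\mathrm C$, the random variables $\|F-F^{(t)}\|_\infty$ and $\|F-F^{(t)}_{\mathrm{mod}}\|_\infty$ are (almost everywhere) measurable, and there is a constant $B>0$, independent of $t$ and of $p$, such that for all integers $t\ge1$ $$\mathbb E\big[\sqrt t\,\|F-F^{(t)}\|_\infty\big]\le B,$$ and for all integers $t\ge1$ and all real $p\ge0$ $$\mathbb E\big[\sqrt t\,\|F-F^{(t)}_{\mathrm{mod}}\|_\infty\big]\le\frac{p+1}{\sqrt{2p+1}}\,B.$$ In particular this holds under the additional assumptions that each sparse coding step has a unique solution and that the surrogate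 functions are strongly convex, which are not needed for it. -/

import Mathlib

open MeasureTheory ProbabilityTheory
open scoped ENNReal

namespace OnlineCDL

/-- Signals `s ∈ ℝ^N`; a coefficient map `x_m` has the same size. The index set `Fin N` carries
arithmetic modulo `N`. -/
abbrev Signal (N : ℕ) : Type := EuclideanSpace ℝ (Fin N)

/-- Dictionaries `d = (d_1, …, d_M)` with filters `d_m ∈ ℝ^L`. -/
abbrev Dictionary (M L : ℕ) : Type := Fin M → EuclideanSpace ℝ (Fin L)

/-- Coefficient maps `x = (x_1, …, x_M)` with `x_m ∈ ℝ^N`. -/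
abbrev CoefMaps (M N : ℕ) : Type := Fin M → Signal N

section
variable {N M L : ℕ} [NeZero N]

/-- Circular convolution of a filter `d ∈ ℝ^L` (zero-padded to `ℝ^N`) with `x ∈ ℝ^N`:
`(d ∗ x)_i = ∑_{j < L} d_j x_{i - j}`, where `i - j` is taken modulo `N`. -/
noncomputable def circConv (d : EuclideanSpace ℝ (Fin L)) (x : Signal N) : Signal N :=
  WithLp.toLp 2 fun i => ∑ j : Fin L, d j * x (i - Fin.ofNat N (j : ℕ))

/-- `X d = ∑_m d_m ∗ x_m`. -/
noncomputable def synth (x : CoefMaps M N) (d : Dictionary M L) : Signal N :=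
  ∑ m, circConv (d m) (x m)

/-- `l(d, x; s) = (1/2) ‖X d - s‖₂² + lam ‖x‖₁`. -/
noncomputable def codingLoss (lam : ℝ) (d : Dictionary M L) (x : CoefMaps M N) (s : Signal N) : ℝ :=
  (1 / 2) * ‖synth x d - s‖ ^ 2 + lam * ∑ m, ∑ i, |x m i|

/-- `f(d; s) = min_x l(d, x; s)`. For `lam > 0` the infimum is attained, see `isLeast_dictLoss`. -/
noncomputable def dictLoss (lam : ℝ) (d : Dictionary M L) (s : Signal N) : ℝ :=
  ⨅ x : CoefMaps M N, codingLoss lam d x s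

/-- The constraint set `C = {d | ‖d_m‖² ≤ 1 for all m}`. -/
def constraintSet (M L : ℕ) : Set (Dictionary M L) := {d | ∀ m, ‖d m‖ ^ 2 ≤ 1}

/-- `F(d) = 𝔼_s [f(d; s)]` for a signal `s` with law `P`. -/
noncomputable def expLoss (lam : ℝ) (P : Measure (Signal N)) (d : Dictionary M L) : ℝ :=
  ∫ s, dictLoss lam d s ∂P

/-- `F^(t)(d) = (1/t) ∑_{τ=1}^t f(d; s^(τ))`; only the entries `s τ` with `1 ≤ τ ≤ t` are used. -/
noncomputable def empLoss (lam : ℝ) (s : ℕ → Signal N) (t : ℕ) (d : Dictionary M L) : ℝ :=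
  (1 / (t : ℝ)) * ∑ τ ∈ Finset.Icc 1 t, dictLoss lam d (s τ)

/-- `Λ^(t) = ∑_{τ=1}^t (τ/t)^p`. -/
noncomputable def weightSum (p : ℝ) (t : ℕ) : ℝ :=
  ∑ τ ∈ Finset.Icc 1 t, ((τ : ℝ) / (t : ℝ)) ^ p

/-- `F_mod^(t)(d) = (1/Λ^(t)) ∑_{τ=1}^t (τ/t)^p f(d; s^(τ))`. -/
noncomputable def modEmpLoss (lam p : ℝ) (s : ℕ → Signal N) (t : ℕ) (d : Dictionary M L) : ℝ :=
  (1 / weightSum p t) * ∑ τ ∈ Finset.Icc 1 t, ((τ : ℝ) / (t : ℝ)) ^ p * dictLoss lam d (s τ)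

/-- `‖g‖_∞ = sup_{d ∈ C} |g(d)|`, with values in `[0, ∞]`. -/
noncomputable def supNorm (g : Dictionary M L → ℝ) : ℝ≥0∞ :=
  ⨆ d ∈ constraintSet M L, ‖g d‖ₑ

theorem continuous_codingLoss (lam : ℝ) (d : Dictionary M L) (s : Signal N) :
    Continuous fun x : CoefMaps M N => codingLoss lam d x s := by
  unfold codingLoss synth circConv
  fun_prop

theorem isLeast_dictLoss {lam : ℝ} (hlam : 0 < lam) (d : Dictionary M L) (s : Signal N) :
    IsLeast (Set.range fun x : CoefMaps M N => codingLoss lam d x s) (dictLoss lam d s) := by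
  have hb : ∀ x : CoefMaps M N, lam * ‖x‖ ≤ codingLoss lam d x s := by
    intro x
    have h1 : ‖x‖ ≤ ∑ m, ∑ i, |x m i| := by
      rw [pi_norm_le_iff_of_nonneg (by positivity)]
      intro m
      have h2 : ‖x m‖ ≤ ∑ i, |x m i| := by
        rw [EuclideanSpace.norm_eq]
        apply Real.sqrt_le_iff.2 ⟨by positivity, ?_⟩
        simpa using Finset.sum_sq_le_sq_sum_of_nonneg (s := Finset.univ)
          (f := fun i => |x m i|) (fun i _ => abs_nonneg _)
      exact h2.trans (Finset.single_le_sum (f := fun m => ∑ i, |x m i|)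
        (fun _ _ => by positivity) (Finset.mem_univ m))
    have h3 := mul_le_mul_of_nonneg_left h1 hlam.le
    unfold codingLoss
    have : 0 ≤ (1 / 2) * ‖synth x d - s‖ ^ 2 := by positivity
    linarith
  obtain ⟨x, hx⟩ := (continuous_codingLoss lam d s).exists_forall_le
    (Filter.tendsto_atTop_mono hb ((tendsto_norm_cocompact_atTop).const_mul_atTop hlam))
  have : dictLoss lam d s = codingLoss lam d x s :=
    le_antisymm (ciInf_le ⟨_, Set.forall_mem_range.2 hx⟩ x) (le_ciInf hx)
  rw [this]
  exact ⟨⟨x, rfl⟩, Set.forall_mem_range.2 hx⟩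

end

end OnlineCDL

/-!
By compactness of the support, `‖s‖ ≤ R` almost surely. A minimiser `x` of `l(d, ·; s)` then has
`lam ‖x‖₁ ≤ R² / 2`, so `d ↦ f(d; s)` is bounded and Lipschitz on a ball around the constraint set,
with constants depending on `R` only (`dictLoss_le`, `dictLoss_sub_le`).

Since the weights `w_τ = (τ/t)^p / Λ` sum to `1`, the difference `F - F_mod^(t)` is the weighted
empirical process `G(d) = ∑ w_τ (F(d) - f(d; s_τ))`. By Hoeffding's lemma its increments are
sub-Gaussian of scale `K σ ‖d - d'‖` with `σ² = ∑ w_τ²` (`exists_hasSubgaussianMGF_sum`). The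
constraint set is the unit ball of a finite-dimensional space, so each of its points is a dyadic
series `∑ 2⁻ᵏ b_k` with digits in a fixed finite set `S`; the `k`-th step of the partial sums takes
at most `|S|^(k+1)` values, each of scale `2⁻ᵏ K σ`. A maximal inequality for finitely many
sub-Gaussian variables (`lintegral_biSup_enorm_le`) and summation over `k` give `𝔼 sup |G| ≤ A K σ`
(`exists_chaining_bound`), with `A` depending on the dimension only.

What remains is deterministic: `√t σ ≤ 2 (p + 1) / √(2 p + 1)` (`sum_sq_weights_le`). The plain
average is the case `p = 0`.
-/

namespace OnlineCDL

/-! ### A maximal inequality for finitely many sub-Gaussian variables -/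

section Maximal

variable {Ω : Type*} [MeasurableSpace Ω] {μ : Measure Ω}

/-- The constant `4` bounds `2 * exp (1 / 2)`. -/
theorem integral_exp_add_exp_neg_le {Y : Ω → ℝ} {c : NNReal} {v : ℝ} (hv : 0 < v)
    (hc : (c : ℝ) ≤ v ^ 2) (hY : HasSubgaussianMGF Y c μ) :
    ∫ ω, (Real.exp (v⁻¹ * Y ω) + Real.exp (-v⁻¹ * Y ω)) ∂μ ≤ 4 := by
  have hs : (c : ℝ) * v⁻¹ ^ 2 ≤ 1 := by
    rw [inv_pow, ← div_eq_mul_inv]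
    exact div_le_one_of_le₀ hc (by positivity)
  have he : Real.exp (1 / 2) ≤ 2 := by
    have h1 : Real.exp (1 / 2) ^ 2 = Real.exp 1 := by
      rw [← Real.exp_nat_mul]; norm_num
    have h2 := Real.exp_one_lt_d9
    nlinarith [Real.exp_pos (1 / 2)]
  have h1 := hY.mgf_le v⁻¹
  have h2 := hY.mgf_le (-v⁻¹)
  have h3 : Real.exp (c * v⁻¹ ^ 2 / 2) ≤ 2 :=
    (Real.exp_le_exp.2 (by linarith)).trans he
  rw [neg_sq] at h2
  rw [integral_add (hY.integrable_exp_mul _) (hY.integrable_exp_mul _)]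
  simp only [mgf] at h1 h2
  linarith

/-- Maximal inequality for finitely many sub-Gaussian variables. It rests on
`x ≤ log n + exp x / n` rather than on Jensen's inequality; the resulting `log n`, in place of the
optimal `√(log n)`, is harmless in the geometric sums of chaining. -/
theorem lintegral_biSup_enorm_le [IsProbabilityMeasure μ] {κ : Type*} (I : Finset κ)
    {n v : ℝ} (hn : 1 ≤ n) (hIn : (I.card : ℝ) ≤ n) (hv : 0 < v) {Y : κ → Ω → ℝ} {c : κ → NNReal}
    (hc : ∀ i ∈ I, (c i : ℝ) ≤ v ^ 2) (hY : ∀ i ∈ I, HasSubgaussianMGF (Y i) (c i) μ) :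
    ∫⁻ ω, ⨆ i ∈ I, ‖Y i ω‖ₑ ∂μ ≤ ENNReal.ofReal (v * (Real.log n + 4)) := by
  have hn0 : 0 < n := by linarith
  set g : κ → Ω → ℝ := fun i ω => Real.exp (v⁻¹ * Y i ω) + Real.exp (-v⁻¹ * Y i ω) with hg
  have hg0 : ∀ i ω, 0 ≤ g i ω := fun i ω => by simp only [hg]; positivity
  have hgi : ∀ i ∈ I, Integrable (g i) μ := fun i hi =>
    ((hY i hi).integrable_exp_mul _).add ((hY i hi).integrable_exp_mul _)
  have hpt : ∀ ω, ⨆ i ∈ I, ‖Y i ω‖ₑ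
      ≤ ENNReal.ofReal (v * (Real.log n + n⁻¹ * ∑ i ∈ I, g i ω)) := by
    intro ω
    refine iSup₂_le fun i hi => ?_
    rw [Real.enorm_eq_ofReal_abs]
    apply ENNReal.ofReal_le_ofReal
    have h1 : Real.exp (v⁻¹ * |Y i ω|) ≤ g i ω := by
      rcases abs_cases (Y i ω) with ⟨h, -⟩ | ⟨h, -⟩ <;> rw [h]
      · exact le_add_of_nonneg_right (Real.exp_pos _).le
      · rw [mul_neg, ← neg_mul]
        exact le_add_of_nonneg_left (Real.exp_pos _).le
    have h2 : g i ω ≤ ∑ i ∈ I, g i ω :=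
      Finset.single_le_sum (f := fun i => g i ω) (fun j _ => hg0 j ω) hi
    have h3 := Real.add_one_le_exp (v⁻¹ * |Y i ω| - Real.log n)
    rw [Real.exp_sub, Real.exp_log hn0, div_eq_inv_mul] at h3
    have h4 : n⁻¹ * Real.exp (v⁻¹ * |Y i ω|) ≤ n⁻¹ * ∑ i ∈ I, g i ω := by
      gcongr; exact h1.trans h2
    calc |Y i ω| = v * (v⁻¹ * |Y i ω|) := by field_simp
      _ ≤ _ := by gcongr; linarith
  have hint : Integrable (fun ω => v * (Real.log n + n⁻¹ * ∑ i ∈ I, g i ω)) μ :=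
    ((integrable_const _).add ((integrable_finsetSum I hgi).const_mul _)).const_mul _
  calc ∫⁻ ω, ⨆ i ∈ I, ‖Y i ω‖ₑ ∂μ
      ≤ ∫⁻ ω, ENNReal.ofReal (v * (Real.log n + n⁻¹ * ∑ i ∈ I, g i ω)) ∂μ := lintegral_mono hpt
    _ = ENNReal.ofReal (∫ ω, v * (Real.log n + n⁻¹ * ∑ i ∈ I, g i ω) ∂μ) := by
      rw [ofReal_integral_eq_lintegral_ofReal hint]
      refine ae_of_all _ fun ω => mul_nonneg hv.le (add_nonneg (Real.log_nonneg hn) ?_)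
      exact mul_nonneg (by positivity) (Finset.sum_nonneg fun i _ => hg0 i ω)
    _ ≤ _ := by
      apply ENNReal.ofReal_le_ofReal
      rw [integral_const_mul, integral_add (integrable_const _)
        ((integrable_finsetSum I hgi).const_mul _), integral_const_mul,
        integral_finsetSum I hgi]
      simp only [integral_const, probReal_univ, one_smul]
      have h1 : ∑ i ∈ I, ∫ ω, g i ω ∂μ ≤ ∑ i ∈ I, (4 : ℝ) :=
        Finset.sum_le_sum fun i hi => integral_exp_add_exp_neg_le hv (hc i hi) (hY i hi)
      have h2 : n⁻¹ * ∑ i ∈ I, ∫ ω, g i ω ∂μ ≤ n⁻¹ * (n * 4) := by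
        gcongr
        refine h1.trans ?_
        rw [Finset.sum_const, nsmul_eq_mul]
        gcongr
      rw [inv_mul_cancel_left₀ hn0.ne'] at h2
      gcongr

end Maximal

/-! ### Chaining on the unit ball -/

section Chaining

variable {E : Type*} [NormedAddCommGroup E] [NormedSpace ℝ E]

/-- Dyadic expansion digits: `dyadicApprox g d k = ∑ j < k, 2⁻ʲ b_j`, where the digit `b_j` is the
value of the rounding map `g` at the rescaled remainder `2ʲ (d - ∑ i < j, 2⁻ⁱ b_i)`. -/
noncomputable def dyadicApprox (g : E → E) (d : E) : ℕ → E
  | 0 => 0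
  | k + 1 => dyadicApprox g d k +
      ((1 / 2 : ℝ) ^ k) • g ((2 : ℝ) ^ k • (d - dyadicApprox g d k))

open Classical in
/-- The points `∑ j < k, 2⁻ʲ b_j` with all digits `b_j` in `S`. -/
noncomputable def dyadicNet (S : Finset E) : ℕ → Finset E
  | 0 => {0}
  | k + 1 => (dyadicNet S k ×ˢ S).image fun x => x.1 + ((1 / 2 : ℝ) ^ k) • x.2

theorem card_dyadicNet_le (S : Finset E) (k : ℕ) : (dyadicNet S k).card ≤ S.card ^ k := by
  classical
  induction k with
  | zero => simp [dyadicNet]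
  | succ k ih =>
    rw [dyadicNet, pow_succ]
    refine Finset.card_image_le.trans ?_
    rw [Finset.card_product]
    gcongr

theorem norm_le_of_mem_dyadicNet {S : Finset E} (hS : ∀ b ∈ S, ‖b‖ ≤ 1) (k : ℕ) :
    ∀ a ∈ dyadicNet S k, ‖a‖ ≤ 2 - 2 * (1 / 2 : ℝ) ^ k := by
  induction k with
  | zero => simp [dyadicNet]
  | succ k ih =>
    intro a ha
    simp only [dyadicNet, Finset.mem_image, Finset.mem_product] at ha
    obtain ⟨⟨x, b⟩, ⟨hx, hb⟩, rfl⟩ := ha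
    have h1 := ih x hx
    have h2 : ‖((1 / 2 : ℝ) ^ k) • b‖ ≤ (1 / 2 : ℝ) ^ k := by
      rw [norm_smul, Real.norm_of_nonneg (by positivity)]
      exact mul_le_of_le_one_right (by positivity) (hS b hb)
    have h3 := norm_add_le x (((1 / 2 : ℝ) ^ k) • b)
    have h4 : (1 / 2 : ℝ) ^ (k + 1) = (1 / 2 : ℝ) ^ k / 2 := by rw [pow_succ]; ring
    simp only
    linarith

theorem norm_sub_dyadicApprox_le {g : E → E} (hg : ∀ x, ‖x‖ ≤ 1 → ‖x - g x‖ ≤ 1 / 2) {d : E}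
    (hd : ‖d‖ ≤ 1) (k : ℕ) : ‖(2 : ℝ) ^ k • (d - dyadicApprox g d k)‖ ≤ 1 := by
  induction k with
  | zero => simpa [dyadicApprox] using hd
  | succ k ih =>
    have h1 := hg _ ih
    set x := (2 : ℝ) ^ k • (d - dyadicApprox g d k) with hx
    have h2 : (2 : ℝ) ^ (k + 1) • (d - dyadicApprox g d (k + 1)) = (2 : ℝ) • (x - g x) := by
      rw [dyadicApprox, ← hx, smul_sub 2, hx, smul_smul, ← pow_succ', sub_add_eq_sub_sub, smul_sub,
        smul_smul, pow_succ' 2 k, mul_assoc, ← mul_pow]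
      norm_num
    rw [h2, norm_smul]
    norm_num
    linarith

theorem dyadicApprox_mem {S : Finset E} {g : E → E} (hgS : ∀ x, ‖x‖ ≤ 1 → g x ∈ S)
    (hg : ∀ x, ‖x‖ ≤ 1 → ‖x - g x‖ ≤ 1 / 2) {d : E} (hd : ‖d‖ ≤ 1) (k : ℕ) :
    dyadicApprox g d k ∈ dyadicNet S k := by
  classical
  induction k with
  | zero => simp [dyadicApprox, dyadicNet]
  | succ k ih =>
    rw [dyadicApprox, dyadicNet, Finset.mem_image]
    exact ⟨(_, _), Finset.mem_product.2 ⟨ih, hgS _ (norm_sub_dyadicApprox_le hg hd k)⟩, rfl⟩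

theorem tendsto_dyadicApprox {g : E → E} (hg : ∀ x, ‖x‖ ≤ 1 → ‖x - g x‖ ≤ 1 / 2) {d : E}
    (hd : ‖d‖ ≤ 1) : Filter.Tendsto (dyadicApprox g d) Filter.atTop (nhds d) := by
  rw [tendsto_iff_norm_sub_tendsto_zero]
  refine squeeze_zero (fun _ => norm_nonneg _) (fun k => ?_)
    (tendsto_pow_atTop_nhds_zero_of_lt_one (r := (1 / 2 : ℝ)) (by norm_num) (by norm_num))
  have h := norm_sub_dyadicApprox_le hg hd k
  rw [norm_smul, Real.norm_of_nonneg (by positivity), norm_sub_rev] at h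
  rw [one_div, inv_pow, ← one_div, le_div_iff₀' (by positivity)]
  exact h

variable (E) in
/-- A finite `1/2`-net of the closed unit ball, together with a rounding map to it. -/
theorem exists_half_net [FiniteDimensional ℝ E] :
    ∃ (S : Finset E) (g : E → E), S.Nonempty ∧ (∀ b ∈ S, ‖b‖ ≤ 1) ∧ (∀ x, ‖x‖ ≤ 1 → g x ∈ S) ∧
      ∀ x, ‖x‖ ≤ 1 → ‖x - g x‖ ≤ 1 / 2 := by
  have : ProperSpace E := FiniteDimensional.proper ℝ E
  obtain ⟨t, ht, htf, hcov⟩ := (isCompact_closedBall (0 : E) 1).finite_cover_balls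
    (e := 1 / 2) (by norm_num)
  have h : ∀ x : E, ∃ b, ‖x‖ ≤ 1 → b ∈ t ∧ ‖x - b‖ ≤ 1 / 2 := by
    intro x
    by_cases hx : ‖x‖ ≤ 1
    · obtain ⟨b, hb, hxb⟩ := Set.mem_iUnion₂.1 (hcov (mem_closedBall_zero_iff.2 hx))
      exact ⟨b, fun _ => ⟨hb, (mem_ball_iff_norm.1 hxb).le⟩⟩
    · exact ⟨0, fun h => absurd h hx⟩
  choose g hg using h
  refine ⟨htf.toFinset, g, ⟨g 0, htf.mem_toFinset.2 (hg 0 (by simp)).1⟩, fun b hb => ?_,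
    fun x hx => htf.mem_toFinset.2 (hg x hx).1, fun x hx => (hg x hx).2⟩
  exact mem_closedBall_zero_iff.1 (ht (htf.mem_toFinset.1 hb))

theorem enorm_le_add_tsum {x : ℕ → ℝ} {l : ℝ} (h : Filter.Tendsto x Filter.atTop (nhds l)) :
    ‖l‖ₑ ≤ ‖x 0‖ₑ + ∑' k, ‖x (k + 1) - x k‖ₑ := by
  refine le_of_tendsto h.enorm (Filter.Eventually.of_forall fun n => ?_)
  have h1 : x n = x 0 + ∑ k ∈ Finset.range n, (x (k + 1) - x k) := by
    rw [Finset.sum_range_sub]; ring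
  calc ‖x n‖ₑ ≤ ‖x 0‖ₑ + ‖∑ k ∈ Finset.range n, (x (k + 1) - x k)‖ₑ := by
        conv_lhs => rw [h1]
        exact enorm_add_le _ _
    _ ≤ ‖x 0‖ₑ + ∑ k ∈ Finset.range n, ‖x (k + 1) - x k‖ₑ := by
        gcongr; exact enorm_sum_le _ _
    _ ≤ _ := by gcongr; exact ENNReal.sum_le_tsum _

variable (E) in
/-- Chaining on the unit ball: a continuous process with sub-Gaussian increments of scale
`σ * ‖a - b‖` has expected supremum at most `A * σ`, where `A` depends on the space only. The
increments are controlled on the ball of radius `2`, as the nets leave the unit ball. -/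
theorem exists_chaining_bound [FiniteDimensional ℝ E] :
    ∃ A : ℝ, 0 < A ∧ ∀ {Ω : Type*} [MeasurableSpace Ω] (μ : Measure Ω) [IsProbabilityMeasure μ]
      (G : E → Ω → ℝ) (σ : ℝ), 0 < σ →
      (∀ ω, ContinuousOn (fun d => G d ω) (Metric.closedBall 0 2)) →
      (∀ a, AEMeasurable (G a) μ) →
      (∃ c : NNReal, (c : ℝ) ≤ σ ^ 2 ∧ HasSubgaussianMGF (G 0) c μ) →
      (∀ a b : E, ‖a‖ ≤ 2 → ‖b‖ ≤ 2 → ∃ c : NNReal, (c : ℝ) ≤ (σ * ‖a - b‖) ^ 2 ∧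
        HasSubgaussianMGF (fun ω => G a ω - G b ω) c μ) →
      ∫⁻ ω, ⨆ d ∈ Metric.closedBall (0 : E) 1, ‖G d ω‖ₑ ∂μ ≤ ENNReal.ofReal (A * σ) := by
  obtain ⟨S, g, hSne, hS, hgS, hg⟩ := exists_half_net E
  set q : ℝ := (S.card : ℝ) with hq
  have hq1 : 1 ≤ q := by
    rw [hq]
    exact_mod_cast hSne.card_pos
  have hlog := Real.log_nonneg hq1
  set r : ℕ → ℝ := fun k => (1 / 2 : ℝ) ^ k * (Real.log (q ^ (k + 1)) + 4) with hr
  have hr0 : ∀ k, 0 ≤ r k := fun k =>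
    mul_nonneg (by positivity) (add_nonneg (Real.log_nonneg (one_le_pow₀ hq1)) (by norm_num))
  have hrs : Summable r := by
    have h1 := summable_pow_mul_geometric_of_norm_lt_one (R := ℝ) 1 (r := 1 / 2) (by norm_num)
    have h2 := summable_geometric_of_lt_one (r := (1 / 2 : ℝ)) (by norm_num) (by norm_num)
    refine ((h1.mul_left (Real.log q)).add (h2.mul_left (Real.log q + 4))).congr fun k => ?_
    simp only [hr, Real.log_pow]
    push_cast
    ring
  refine ⟨4 + ∑' k, r k, add_pos_of_pos_of_nonneg (by norm_num) (tsum_nonneg hr0), ?_⟩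
  intro Ω _ μ _ G σ hσ hcont hmeas h0 hinc
  set J : ℕ → Ω → ℝ≥0∞ := fun k ω => ⨆ x ∈ dyadicNet S k ×ˢ S,
    ‖G (x.1 + ((1 / 2 : ℝ) ^ k) • x.2) ω - G x.1 ω‖ₑ with hJ
  have hJm : ∀ k, AEMeasurable (J k) μ := fun k =>
    AEMeasurable.biSup _ (Finset.countable_toSet _) fun x _ => ((hmeas _).sub (hmeas _)).enorm
  have hJb : ∀ k, ∫⁻ ω, J k ω ∂μ ≤ ENNReal.ofReal (σ * r k) := by
    intro k
    have hpair : ∀ x ∈ dyadicNet S k ×ˢ S, ∃ c : NNReal, (c : ℝ) ≤ (σ * (1 / 2 : ℝ) ^ k) ^ 2 ∧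
        HasSubgaussianMGF (fun ω => G (x.1 + ((1 / 2 : ℝ) ^ k) • x.2) ω - G x.1 ω) c μ := by
      rintro ⟨a, b⟩ hab
      obtain ⟨ha, hb⟩ := Finset.mem_product.1 hab
      have hna := norm_le_of_mem_dyadicNet hS k a ha
      have hnb : ‖((1 / 2 : ℝ) ^ k) • b‖ ≤ (1 / 2 : ℝ) ^ k := by
        rw [norm_smul, Real.norm_of_nonneg (by positivity)]
        exact mul_le_of_le_one_right (by positivity) (hS b hb)
      have hpos : 0 < (1 / 2 : ℝ) ^ k := by positivity
      obtain ⟨c, hc, h⟩ := hinc (a + ((1 / 2 : ℝ) ^ k) • b) a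
        ((norm_add_le _ _).trans (by linarith)) (by linarith)
      refine ⟨c, hc.trans ?_, h⟩
      rw [add_sub_cancel_left]
      gcongr
    choose! c hc hsub using hpair
    have h := lintegral_biSup_enorm_le (n := q ^ (k + 1)) (v := σ * (1 / 2 : ℝ) ^ k) (μ := μ)
      (dyadicNet S k ×ˢ S) (one_le_pow₀ hq1) ?_ (by positivity) hc hsub
    · rwa [mul_assoc] at h
    · rw [Finset.card_product, pow_succ, hq]
      exact_mod_cast Nat.mul_le_mul_right _ (card_dyadicNet_le S k)
  obtain ⟨c0, hc0, hsub0⟩ := h0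
  have h0b : ∫⁻ ω, ‖G 0 ω‖ₑ ∂μ ≤ ENNReal.ofReal (σ * 4) := by
    have h := lintegral_biSup_enorm_le (n := 1) (v := σ) (μ := μ) ({()} : Finset Unit)
      (Y := fun _ => G 0) (c := fun _ => c0) le_rfl (by simp) hσ (by simpa using hc0)
      (by simpa using hsub0)
    simpa using h
  calc ∫⁻ ω, ⨆ d ∈ Metric.closedBall (0 : E) 1, ‖G d ω‖ₑ ∂μ
      ≤ ∫⁻ ω, (‖G 0 ω‖ₑ + ∑' k, J k ω) ∂μ := by
        refine lintegral_mono fun ω => iSup₂_le fun d hd => ?_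
        have hd1 : ‖d‖ ≤ 1 := mem_closedBall_zero_iff.1 hd
        have hmem : ∀ k, dyadicApprox g d k ∈ Metric.closedBall (0 : E) 2 := fun k => by
          have h := norm_le_of_mem_dyadicNet hS k _ (dyadicApprox_mem hgS hg hd1 k)
          have hpos : 0 < (1 / 2 : ℝ) ^ k := by positivity
          exact mem_closedBall_zero_iff.2 (by linarith)
        have hlim : Filter.Tendsto (fun k => G (dyadicApprox g d k) ω) Filter.atTop
            (nhds (G d ω)) :=
          (hcont ω d (Metric.closedBall_subset_closedBall (by norm_num) hd)).tendsto.comp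
            (tendsto_nhdsWithin_iff.2 ⟨tendsto_dyadicApprox hg hd1,
              Filter.Eventually.of_forall hmem⟩)
        refine (enorm_le_add_tsum hlim).trans ?_
        gcongr with k
        · rfl
        · exact le_iSup₂_of_le (f := fun (x : E × E) (_ : x ∈ dyadicNet S k ×ˢ S) =>
              ‖G (x.1 + ((1 / 2 : ℝ) ^ k) • x.2) ω - G x.1 ω‖ₑ) (_, _)
            (Finset.mem_product.2 ⟨dyadicApprox_mem hgS hg hd1 k,
              hgS _ (norm_sub_dyadicApprox_le hg hd1 k)⟩) le_rfl
    _ = ∫⁻ ω, ‖G 0 ω‖ₑ ∂μ + ∑' k, ∫⁻ ω, J k ω ∂μ := by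
        rw [lintegral_add_left' (hmeas 0).enorm, lintegral_tsum hJm]
    _ ≤ ENNReal.ofReal (σ * 4) + ∑' k, ENNReal.ofReal (σ * r k) :=
        add_le_add h0b (ENNReal.tsum_le_tsum hJb)
    _ = ENNReal.ofReal ((4 + ∑' k, r k) * σ) := by
        rw [← ENNReal.ofReal_tsum_of_nonneg (fun k => mul_nonneg hσ.le (hr0 k))
          (hrs.mul_left σ), tsum_mul_left, ← ENNReal.ofReal_add (by positivity)
          (mul_nonneg hσ.le (tsum_nonneg hr0))]
        congr 1
        ring

end Chaining

/-! ### Weighted empirical processes of Lipschitz classes -/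

section EmpiricalProcess

variable {S : Type*} [MeasurableSpace S] {Q : Measure S}
  {Ω : Type*} [MeasurableSpace Ω] {μ : Measure Ω} [IsProbabilityMeasure μ]

/-- Hoeffding's lemma for weighted centred sums of a bounded function of independent samples. -/
theorem exists_hasSubgaussianMGF_sum {φ : S → ℝ} (hφ : Measurable φ) {κ : ℝ} (hκ : 0 ≤ κ)
    (hb : ∀ᵐ x ∂Q, |φ x| ≤ κ) {ι : Type*} (T : Finset ι) {X : ι → Ω → S}
    (hX : ∀ i, HasLaw (X i) Q μ) (hind : iIndepFun X μ) (w : ι → ℝ) {σ : ℝ}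
    (hw : ∑ i ∈ T, w i ^ 2 ≤ σ ^ 2) :
    ∃ c : NNReal, (c : ℝ) ≤ (σ * κ) ^ 2 ∧
      HasSubgaussianMGF (fun ω => ∑ i ∈ T, w i * (∫ x, φ x ∂Q - φ (X i ω))) c μ := by
  have hone : ∀ i, HasSubgaussianMGF (fun ω => w i * (∫ x, φ x ∂Q - φ (X i ω)))
      (‖w i‖₊ ^ 2 * (‖κ - -κ‖₊ / 2) ^ 2) μ := by
    intro i
    have hbi : ∀ᵐ ω ∂μ, φ (X i ω) ∈ Set.Icc (-κ) κ := by
      have h := hb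
      rw [← (hX i).map_eq] at h
      filter_upwards [ae_of_ae_map (hX i).aemeasurable h] with ω hω
      exact abs_le.1 hω
    have hint : ∫ ω, φ (X i ω) ∂μ = ∫ x, φ x ∂Q := by
      rw [← (hX i).map_eq, integral_map (hX i).aemeasurable hφ.aestronglyMeasurable]
    have h := (hasSubgaussianMGF_of_mem_Icc
      (hφ.comp_aemeasurable (hX i).aemeasurable) hbi).const_mul (-w i)
    have hw2 : (⟨(-w i) ^ 2, sq_nonneg (-w i)⟩ : NNReal) = ‖w i‖₊ ^ 2 :=
      NNReal.eq ((neg_sq (w i)).trans (sq_abs (w i)).symm)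
    rw [hw2] at h
    refine h.congr (ae_of_all _ fun ω => ?_)
    simp only [Function.comp_apply, hint]
    ring
  have hind' : iIndepFun (fun i ω => w i * (∫ x, φ x ∂Q - φ (X i ω))) μ :=
    hind.comp (fun i x => w i * (∫ y, φ y ∂Q - φ x)) fun i => by fun_prop
  refine ⟨_, ?_, HasSubgaussianMGF.sum_of_iIndepFun hind' fun i (_ : i ∈ T) => hone i⟩
  have hk : ‖κ - -κ‖ / 2 = κ := by
    rw [Real.norm_of_nonneg (by linarith)]; ring
  push_cast
  rw [← Finset.sum_mul, hk, mul_pow]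
  simp only [Real.norm_eq_abs, sq_abs]
  gcongr

/-- Expected supremum over the unit ball of the weighted empirical process of a class
`d ↦ h d` that is Lipschitz in the parameter: it is of the order of the Euclidean norm of the
weights. -/
theorem exists_lintegral_iSup_le {E : Type*} [NormedAddCommGroup E] [NormedSpace ℝ E]
    [FiniteDimensional ℝ E] {h : E → S → ℝ} (hmeas : ∀ d, Measurable (h d))
    (hcont : ∀ x, ContinuousOn (fun d => h d x) (Metric.closedBall 0 2))
    (hcontF : ContinuousOn (fun d => ∫ x, h d x ∂Q) (Metric.closedBall 0 2))
    (hint : ∀ d, ‖d‖ ≤ 2 → Integrable (h d) Q) {K : ℝ} (hK : 0 < K)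
    (hlip : ∀ᵐ x ∂Q, ∀ a b, ‖a‖ ≤ 2 → ‖b‖ ≤ 2 → |h a x - h b x| ≤ K * ‖a - b‖)
    (h0 : ∀ᵐ x ∂Q, |h 0 x| ≤ K) :
    ∃ B : ℝ, 0 < B ∧ ∀ {Ω : Type*} [MeasurableSpace Ω] (μ : Measure Ω) [IsProbabilityMeasure μ]
      {ι : Type} (T : Finset ι) (X : ι → Ω → S), (∀ i, HasLaw (X i) Q μ) → iIndepFun X μ →
      ∀ (w : ι → ℝ) (σ : ℝ), 0 < σ → ∑ i ∈ T, w i ^ 2 ≤ σ ^ 2 →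
      ∫⁻ ω, ⨆ d ∈ Metric.closedBall (0 : E) 1,
        ‖∑ i ∈ T, w i * (∫ x, h d x ∂Q - h d (X i ω))‖ₑ ∂μ ≤ ENNReal.ofReal (B * σ) := by
  obtain ⟨A, hA, hchain⟩ := exists_chaining_bound E
  refine ⟨A * K, by positivity, ?_⟩
  intro Ω _ μ _ ι T X hX hind w σ hσ hw
  rw [mul_assoc]
  refine hchain μ _ (K * σ) (by positivity) (fun ω => ?_) (fun a => ?_) ?_ ?_
  · exact continuousOn_finsetSum _ fun i _ =>
      continuousOn_const.mul (hcontF.sub (hcont _))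
  · refine Finset.aemeasurable_fun_sum _ fun i _ => ?_
    have := (hmeas a).comp_aemeasurable (hX i).aemeasurable
    exact (aemeasurable_const.sub this).const_mul _
  · rw [mul_comm K σ]
    exact exists_hasSubgaussianMGF_sum (hmeas 0) hK.le h0 T hX hind w hw
  · intro a b ha hb
    obtain ⟨c, hc, hsub⟩ := exists_hasSubgaussianMGF_sum (φ := fun x => h a x - h b x)
      ((hmeas a).sub (hmeas b)) (κ := K * ‖a - b‖) (by positivity)
      (hlip.mono fun x hx => hx a b ha hb) T hX hind w hw
    refine ⟨c, hc.trans_eq (by ring), hsub.congr (ae_of_all _ fun ω => ?_)⟩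
    simp only
    rw [integral_sub (hint a ha) (hint b hb), ← Finset.sum_sub_distrib]
    exact Finset.sum_congr rfl fun i _ => by ring

/-- A supremum of continuous functions of the parameter is a supremum over a countable dense set
of parameters, hence measurable. -/
theorem aemeasurable_biSup_enorm {E : Type*} [TopologicalSpace E] [SecondCountableTopology E]
    {C : Set E} (hC : C.Nonempty) {ν : Measure Ω} {G : E → Ω → ℝ}
    (hmeas : ∀ d, AEMeasurable (G d) ν) (hcont : ∀ ω, ContinuousOn (fun d => G d ω) C) :
    AEMeasurable (fun ω => ⨆ d ∈ C, ‖G d ω‖ₑ) ν := by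
  have : Nonempty C := hC.to_subtype
  have heq : (fun ω => ⨆ d ∈ C, ‖G d ω‖ₑ)
      = fun ω => ⨆ n, ‖G (TopologicalSpace.denseSeq C n) ω‖ₑ := by
    funext ω
    refine le_antisymm (iSup₂_le fun d hd => ?_) (iSup_le fun n =>
      le_iSup₂_of_le (f := fun d (_ : d ∈ C) => ‖G d ω‖ₑ) _
        (TopologicalSpace.denseSeq C n).2 le_rfl)
    have hc : Continuous fun d : C => ‖G d ω‖ₑ := (hcont ω).domRestrict.enorm
    exact (TopologicalSpace.denseRange_denseSeq C).induction_on
      (p := fun d : C => ‖G d ω‖ₑ ≤ ⨆ n, ‖G (TopologicalSpace.denseSeq C n) ω‖ₑ) ⟨d, hd⟩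
      (isClosed_le hc continuous_const) fun n =>
        le_iSup (fun n => ‖G (TopologicalSpace.denseSeq C n) ω‖ₑ) n
  rw [heq]
  exact AEMeasurable.iSup fun n => (hmeas _).enorm

end EmpiricalProcess

/-! ### Regularity of the sparse coding loss -/

section Loss

variable {N M L : ℕ} [NeZero N]

theorem norm_le_sum_abs {n : ℕ} (x : EuclideanSpace ℝ (Fin n)) : ‖x‖ ≤ ∑ i, |x i| := by
  rw [EuclideanSpace.norm_eq]
  apply Real.sqrt_le_iff.2 ⟨by positivity, ?_⟩
  simpa using Finset.sum_sq_le_sq_sum_of_nonneg (s := Finset.univ)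
    (f := fun i => |x i|) (fun i _ => abs_nonneg _)

theorem norm_circConv_le (d : EuclideanSpace ℝ (Fin L)) (x : Signal N) :
    ‖circConv d x‖ ≤ N * L * ‖d‖ * ‖x‖ := by
  have hi : ∀ i, |circConv d x i| ≤ L * (‖d‖ * ‖x‖) := fun i => by
    change |∑ j : Fin L, d j * x (i - Fin.ofNat N (j : ℕ))| ≤ _
    refine (Finset.abs_sum_le_sum_abs _ _).trans ?_
    have h := Finset.sum_le_card_nsmul Finset.univ
      (fun j : Fin L => |d j * x (i - Fin.ofNat N (j : ℕ))|) (‖d‖ * ‖x‖) fun j _ => by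
        rw [abs_mul]
        exact mul_le_mul (PiLp.norm_apply_le d j) (PiLp.norm_apply_le x _) (abs_nonneg _)
          (norm_nonneg _)
    simpa using h
  refine (norm_le_sum_abs _).trans ?_
  have h := Finset.sum_le_card_nsmul Finset.univ _ _ fun i _ => hi i
  refine h.trans_eq ?_
  simp only [Finset.card_univ, Fintype.card_fin, nsmul_eq_mul]
  ring

theorem norm_synth_le (x : CoefMaps M N) (d : Dictionary M L) :
    ‖synth x d‖ ≤ N * L * (∑ m, ∑ i, |x m i|) * ‖d‖ := by
  refine (norm_sum_le _ _).trans ?_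
  rw [Finset.mul_sum, Finset.sum_mul]
  refine Finset.sum_le_sum fun m _ => (norm_circConv_le _ _).trans ?_
  rw [mul_right_comm]
  gcongr
  · exact norm_le_sum_abs _
  · exact norm_le_pi_norm d m

theorem synth_sub (x : CoefMaps M N) (d d' : Dictionary M L) :
    synth x (d - d') = synth x d - synth x d' := by
  simp only [synth, ← Finset.sum_sub_distrib]
  refine Finset.sum_congr rfl fun m _ => ?_
  ext i
  simp [circConv, sub_mul, Finset.sum_sub_distrib]

theorem codingLoss_nonneg {lam : ℝ} (hlam : 0 < lam) (d : Dictionary M L) (x : CoefMaps M N)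
    (s : Signal N) : 0 ≤ codingLoss lam d x s := by
  unfold codingLoss
  positivity

theorem dictLoss_nonneg {lam : ℝ} (hlam : 0 < lam) (d : Dictionary M L) (s : Signal N) :
    0 ≤ dictLoss lam d s :=
  Real.iInf_nonneg fun x => codingLoss_nonneg hlam d x s

theorem dictLoss_le_codingLoss {lam : ℝ} (hlam : 0 < lam) (d : Dictionary M L)
    (x : CoefMaps M N) (s : Signal N) : dictLoss lam d s ≤ codingLoss lam d x s :=
  (isLeast_dictLoss hlam d s).2 ⟨x, rfl⟩

theorem dictLoss_le {lam : ℝ} (hlam : 0 < lam) (d : Dictionary M L) (s : Signal N) :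
    dictLoss lam d s ≤ ‖s‖ ^ 2 / 2 := by
  refine (dictLoss_le_codingLoss hlam d 0 s).trans_eq ?_
  have h : synth (0 : CoefMaps M N) d = 0 := by
    refine norm_le_zero_iff.1 ((norm_synth_le _ _).trans_eq ?_)
    simp
  simp [codingLoss, h]
  ring

theorem measurable_dictLoss {lam : ℝ} (hlam : 0 < lam) (d : Dictionary M L) :
    Measurable fun s : Signal N => dictLoss lam d s := by
  refine (upperSemicontinuous_ciInf (fun s => ⟨0, ?_⟩) fun x => ?_).measurable
  · rintro _ ⟨x, rfl⟩
    exact codingLoss_nonneg hlam d x s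
  · refine Continuous.upperSemicontinuous ?_
    unfold codingLoss
    fun_prop

/-- A minimiser `x` of `l(d', ·; s)` satisfies `lam ‖x‖₁ ≤ ‖s‖² / 2`, and for such `x` the loss
`l(d, x; s)` is Lipschitz in `d`. -/
theorem dictLoss_sub_le {lam : ℝ} (hlam : 0 < lam) {R : ℝ} {s : Signal N} (hs : ‖s‖ ≤ R)
    {d d' : Dictionary M L} (hd : ‖d‖ ≤ 2) (hd' : ‖d'‖ ≤ 2) :
    dictLoss lam d s - dictLoss lam d' s ≤
      N * L * (R ^ 2 / 2 / lam) * (N * L * (R ^ 2 / 2 / lam) * 2 + R) * ‖d - d'‖ := by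
  obtain ⟨x, hx⟩ := (isLeast_dictLoss hlam d' s).1
  simp only at hx
  have h1 := dictLoss_le_codingLoss hlam d x s
  set a := ∑ m, ∑ i, |x m i| with ha
  have ha0 : 0 ≤ a := by positivity
  have haR : a ≤ R ^ 2 / 2 / lam := by
    rw [le_div_iff₀ hlam, mul_comm]
    have h2 := dictLoss_le hlam d' s
    rw [← hx, codingLoss] at h2
    have h3 : ‖s‖ ^ 2 ≤ R ^ 2 := by gcongr
    have h4 : 0 ≤ 1 / 2 * ‖synth x d' - s‖ ^ 2 := by positivity
    linarith
  set A := R ^ 2 / 2 / lam with hA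
  have hb : ∀ e : Dictionary M L, ‖synth x e‖ ≤ N * L * A * ‖e‖ := fun e =>
    (norm_synth_le x e).trans (by gcongr)
  have hu : ∀ e : Dictionary M L, ‖e‖ ≤ 2 → ‖synth x e - s‖ ≤ N * L * A * 2 + R := fun e he =>
    (norm_sub_le _ _).trans (add_le_add ((hb e).trans (by
      have : 0 ≤ A := ha0.trans haR
      gcongr)) hs)
  have hdiff : ‖synth x d - s‖ - ‖synth x d' - s‖ ≤ N * L * A * ‖d - d'‖ := by
    refine (norm_sub_norm_le _ _).trans ?_
    rw [sub_sub_sub_cancel_right, ← synth_sub]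
    exact hb _
  have hu1 := hu d hd
  have hu2 := hu d' hd'
  have hA0 : 0 ≤ A := ha0.trans haR
  have hD0 : 0 ≤ N * L * A * ‖d - d'‖ := by positivity
  calc dictLoss lam d s - dictLoss lam d' s
      ≤ codingLoss lam d x s - codingLoss lam d' x s := by rw [hx]; linarith
    _ = 1 / 2 * ((‖synth x d - s‖ - ‖synth x d' - s‖)
          * (‖synth x d - s‖ + ‖synth x d' - s‖)) := by
        unfold codingLoss; ring
    _ ≤ 1 / 2 * (N * L * A * ‖d - d'‖ * ((N * L * A * 2 + R) + (N * L * A * 2 + R))) := by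
        gcongr
    _ = _ := by ring

theorem exists_dictLoss_lipschitz {lam : ℝ} (hlam : 0 < lam) (R : ℝ) :
    ∃ K : ℝ, 0 < K ∧ ∀ s : Signal N, ‖s‖ ≤ R → ∀ d d' : Dictionary M L, ‖d‖ ≤ 2 → ‖d'‖ ≤ 2 →
      |dictLoss lam d s - dictLoss lam d' s| ≤ K * ‖d - d'‖ := by
  refine ⟨_, lt_of_lt_of_le one_pos (le_max_right
    (N * L * (R ^ 2 / 2 / lam) * (N * L * (R ^ 2 / 2 / lam) * 2 + R)) 1), ?_⟩
  intro s hs d d' hd hd'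
  rw [abs_le']
  constructor
  · refine (dictLoss_sub_le hlam hs hd hd').trans ?_
    gcongr
    exact le_max_left _ _
  · rw [neg_sub, norm_sub_rev]
    refine (dictLoss_sub_le hlam hs hd' hd).trans ?_
    gcongr
    exact le_max_left _ _

theorem continuousOn_of_abs_sub_le {E : Type*} [NormedAddCommGroup E] {f : E → ℝ} {K r : ℝ}
    (h : ∀ a b, ‖a‖ ≤ r → ‖b‖ ≤ r → |f a - f b| ≤ K * ‖a - b‖) :
    ContinuousOn f (Metric.closedBall 0 r) := by
  refine LipschitzOnWith.continuousOn (K := K.toNNReal) (.of_dist_le_mul fun a ha b hb => ?_)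
  rw [Real.dist_eq, dist_eq_norm]
  refine (h a b (mem_closedBall_zero_iff.1 ha) (mem_closedBall_zero_iff.1 hb)).trans ?_
  gcongr
  exact Real.le_coe_toNNReal K

theorem constraintSet_eq_closedBall (M L : ℕ) :
    constraintSet M L = Metric.closedBall (0 : Dictionary M L) 1 := by
  ext d
  rw [mem_closedBall_zero_iff, pi_norm_le_iff_of_nonneg zero_le_one]
  simp [constraintSet]

end Loss

/-! ### Square sums of polynomial weights -/

section Weights

theorem rpow_succ_le_mul_sum {p : ℝ} (hp : 0 ≤ p) (t : ℕ) :
    (t : ℝ) ^ (p + 1) ≤ (p + 1) * ∑ τ ∈ Finset.Icc 1 t, (τ : ℝ) ^ p := by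
  induction t with
  | zero => simp [Real.zero_rpow (by linarith : p + 1 ≠ 0)]
  | succ n ih =>
    rw [Finset.sum_Icc_succ_top (by omega), mul_add]
    have hx : (0 : ℝ) < (n + 1 : ℕ) := by positivity
    have hb := one_add_mul_self_le_rpow_one_add (s := -1 / ((n + 1 : ℕ) : ℝ)) (by
      rw [le_div_iff₀ hx]; push_cast; linarith [(n.cast_nonneg : (0 : ℝ) ≤ n)])
      (p := p + 1) (by linarith)
    have he : 1 + -1 / ((n + 1 : ℕ) : ℝ) = n / ((n + 1 : ℕ) : ℝ) := by
      field_simp; push_cast; ring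
    rw [he, Real.div_rpow (by positivity) hx.le, le_div_iff₀ (by positivity)] at hb
    have hr : ((n + 1 : ℕ) : ℝ) ^ (p + 1) = ((n + 1 : ℕ) : ℝ) ^ p * ((n + 1 : ℕ) : ℝ) := by
      rw [Real.rpow_add_one hx.ne']
    have h2 : (1 + (p + 1) * (-1 / ((n + 1 : ℕ) : ℝ))) * ((n + 1 : ℕ) : ℝ) ^ (p + 1)
        = ((n + 1 : ℕ) : ℝ) ^ (p + 1) - (p + 1) * ((n + 1 : ℕ) : ℝ) ^ p := by
      rw [hr]; field_simp; ring
    linarith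

theorem sum_rpow_le {q : ℝ} (hq : 0 ≤ q) (t : ℕ) :
    ∑ τ ∈ Finset.Icc 1 t, (τ : ℝ) ^ q ≤ (t : ℝ) ^ (q + 1) / (q + 1) + (t : ℝ) ^ q := by
  induction t with
  | zero => simp only [Finset.Icc_eq_empty_of_lt zero_lt_one, Finset.sum_empty]; positivity
  | succ n ih =>
    rw [Finset.sum_Icc_succ_top (by omega)]
    have hq1 : 0 < q + 1 := by linarith
    suffices h : (n : ℝ) ^ (q + 1) + (q + 1) * (n : ℝ) ^ q ≤ ((n + 1 : ℕ) : ℝ) ^ (q + 1) by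
      have h' : (n : ℝ) ^ (q + 1) / (q + 1) + (n : ℝ) ^ q
          ≤ ((n + 1 : ℕ) : ℝ) ^ (q + 1) / (q + 1) := by
        rw [le_div_iff₀ hq1, add_mul, div_mul_cancel₀ _ hq1.ne']
        linarith
      linarith
    rcases n.eq_zero_or_pos with rfl | hn
    · rcases hq.eq_or_lt with rfl | hq0
      · simp
      · simp [Real.zero_rpow hq0.ne', Real.zero_rpow hq1.ne']
    · have hx : (0 : ℝ) < n := by exact_mod_cast hn
      have hb := one_add_mul_self_le_rpow_one_add (s := 1 / (n : ℝ)) (by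
        have : 0 < 1 / (n : ℝ) := by positivity
        linarith) (p := q + 1) (by linarith)
      have he : 1 + 1 / (n : ℝ) = ((n + 1 : ℕ) : ℝ) / n := by field_simp; push_cast; ring
      rw [he, Real.div_rpow (by positivity) hx.le, le_div_iff₀ (by positivity)] at hb
      refine le_trans (le_of_eq ?_) hb
      rw [Real.rpow_add_one hx.ne']
      field_simp

theorem weightSum_pos {p : ℝ} {t : ℕ} (ht : 1 ≤ t) : 0 < weightSum p t := by
  refine Finset.sum_pos (fun τ hτ => ?_) ⟨1, by simpa using ht⟩
  have h1 : (0 : ℝ) < τ := by exact_mod_cast (Finset.mem_Icc.1 hτ).1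
  have h2 : (0 : ℝ) < t := by exact_mod_cast ht
  positivity

/-- For `t ≥ 2 p + 1` the bound comes from comparing both sums with integrals; for smaller `t` it
suffices that the normalised weights have square sum at most `1`, since
`2 p + 1 ≤ 4 (p + 1) ^ 2 / (2 p + 1)`. -/
theorem sum_sq_weights_le {p : ℝ} (hp : 0 ≤ p) {t : ℕ} (ht : 1 ≤ t) :
    ∑ τ ∈ Finset.Icc 1 t, ((1 / weightSum p t) * ((τ : ℝ) / t) ^ p) ^ 2
      ≤ (2 * ((p + 1) / √(2 * p + 1)) / √t) ^ 2 := by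
  have ht0 : (0 : ℝ) < t := by exact_mod_cast ht
  have h2p : 0 < 2 * p + 1 := by linarith
  set V := ∑ τ ∈ Finset.Icc 1 t, (τ : ℝ) ^ p with hV
  have htp : 0 < (t : ℝ) ^ p := by positivity
  have hW : weightSum p t = V / (t : ℝ) ^ p := by
    rw [weightSum, hV, Finset.sum_div]
    exact Finset.sum_congr rfl fun τ _ => Real.div_rpow (by positivity) (by positivity) _
  have hV0 : 0 < V := by
    have := weightSum_pos (p := p) ht
    rw [hW] at this
    exact (div_pos_iff_of_pos_right htp).1 this
  have hlhs : ∑ τ ∈ Finset.Icc 1 t, ((1 / weightSum p t) * ((τ : ℝ) / t) ^ p) ^ 2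
      = (∑ τ ∈ Finset.Icc 1 t, (τ : ℝ) ^ (2 * p)) / V ^ 2 := by
    rw [Finset.sum_div]
    refine Finset.sum_congr rfl fun τ _ => ?_
    rw [hW, Real.div_rpow (by positivity) (by positivity), mul_comm 2 p,
      Real.rpow_mul (by positivity), Real.rpow_two]
    field_simp
  have hrhs : (2 * ((p + 1) / √(2 * p + 1)) / √t) ^ 2 = 4 * (p + 1) ^ 2 / ((2 * p + 1) * t) := by
    rw [div_pow, mul_pow, div_pow, Real.sq_sqrt h2p.le, Real.sq_sqrt ht0.le]
    field_simp
    norm_num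
  rw [hlhs, hrhs, div_le_div_iff₀ (by positivity) (by positivity)]
  rcases le_total (2 * p + 1) t with h | h
  · have h1 := sum_rpow_le (q := 2 * p) (by linarith) t
    have h2 := rpow_succ_le_mul_sum hp t
    rw [Real.rpow_add_one ht0.ne'] at h1 h2
    have h3 : (t : ℝ) ^ (2 * p) = ((t : ℝ) ^ p) ^ 2 := by
      rw [mul_comm 2 p, Real.rpow_mul (by positivity), Real.rpow_two]
    rw [h3] at h1
    have h4 : (((t : ℝ) ^ p) * t) ^ 2 ≤ ((p + 1) * V) ^ 2 := by gcongr
    calc _ ≤ (((t : ℝ) ^ p) ^ 2 * t / (2 * p + 1) + ((t : ℝ) ^ p) ^ 2) * ((2 * p + 1) * t) := by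
          gcongr
      _ = ((t : ℝ) ^ p) ^ 2 * t * (t + (2 * p + 1)) := by field_simp
      _ ≤ ((t : ℝ) ^ p) ^ 2 * t * (t + t) := by gcongr
      _ = 2 * (((t : ℝ) ^ p) * t) ^ 2 := by ring
      _ ≤ 4 * (((t : ℝ) ^ p) * t) ^ 2 := by gcongr; norm_num
      _ ≤ 4 * ((p + 1) * V) ^ 2 := by gcongr
      _ = _ := by ring
  · have h1 : ∑ τ ∈ Finset.Icc 1 t, (τ : ℝ) ^ (2 * p) ≤ V ^ 2 := by
      have := Finset.sum_sq_le_sq_sum_of_nonneg (s := Finset.Icc 1 t)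
        (f := fun τ : ℕ => (τ : ℝ) ^ p) (fun i _ => by positivity)
      refine le_trans (le_of_eq (Finset.sum_congr rfl fun τ _ => ?_)) this
      rw [mul_comm 2 p, Real.rpow_mul (by positivity), Real.rpow_two]
    calc _ ≤ V ^ 2 * ((2 * p + 1) * (2 * p + 1)) := by gcongr
      _ ≤ V ^ 2 * (4 * (p + 1) ^ 2) :=
          mul_le_mul_of_nonneg_left (by nlinarith) (by positivity)
      _ = _ := by ring

theorem empLoss_eq_modEmpLoss {N M L : ℕ} [NeZero N] (lam : ℝ) (s : ℕ → Signal N) (t : ℕ)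
    (d : Dictionary M L) : empLoss lam s t d = modEmpLoss lam 0 s t d := by
  simp [empLoss, modEmpLoss, weightSum]

end Weights

/-! ### The loss as a weighted empirical process -/

section Law

variable {N M L : ℕ} [NeZero N] {lam : ℝ}

theorem exists_ae_norm_le {n : ℕ} (P : Measure (Signal n)) (hP : IsCompact P.support) :
    ∃ R : ℝ, ∀ᵐ s ∂P, ‖s‖ ≤ R := by
  obtain ⟨R, hR⟩ := hP.isBounded.exists_norm_le
  exact ⟨R, Filter.mem_of_superset Measure.support_mem_ae hR⟩

theorem abs_dictLoss_le (hlam : 0 < lam) {R : ℝ} {s : Signal N} (hs : ‖s‖ ≤ R)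
    (d : Dictionary M L) : |dictLoss lam d s| ≤ R ^ 2 / 2 := by
  rw [abs_of_nonneg (dictLoss_nonneg hlam d s)]
  have h := dictLoss_le hlam d s
  have h2 : ‖s‖ ^ 2 ≤ R ^ 2 := by gcongr
  linarith

theorem integrable_dictLoss (hlam : 0 < lam) {P : Measure (Signal N)} [IsProbabilityMeasure P]
    {R : ℝ} (hR : ∀ᵐ s ∂P, ‖s‖ ≤ R) (d : Dictionary M L) :
    Integrable (fun s => dictLoss lam d s) P :=
  Integrable.of_bound (measurable_dictLoss hlam d).aestronglyMeasurable (R ^ 2 / 2)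
    (hR.mono fun _ hs => abs_dictLoss_le hlam hs d)

theorem continuousOn_dictLoss (hlam : 0 < lam) (s : Signal N) :
    ContinuousOn (fun d : Dictionary M L => dictLoss lam d s) (Metric.closedBall 0 2) := by
  obtain ⟨K, -, hK⟩ := exists_dictLoss_lipschitz (N := N) (M := M) (L := L) hlam ‖s‖
  exact continuousOn_of_abs_sub_le (hK s le_rfl)

theorem continuousOn_expLoss (hlam : 0 < lam) {P : Measure (Signal N)} [IsProbabilityMeasure P]
    {R : ℝ} (hR : ∀ᵐ s ∂P, ‖s‖ ≤ R) :
    ContinuousOn (fun d : Dictionary M L => expLoss lam P d) (Metric.closedBall 0 2) := by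
  obtain ⟨K, -, hK⟩ := exists_dictLoss_lipschitz (N := N) (M := M) (L := L) hlam R
  refine continuousOn_of_abs_sub_le (K := K) fun a b ha hb => ?_
  simp only [expLoss]
  rw [← integral_sub (integrable_dictLoss hlam hR a) (integrable_dictLoss hlam hR b)]
  have h := norm_integral_le_of_norm_le_const (μ := P) (C := K * ‖a - b‖)
    (f := fun s => dictLoss lam a s - dictLoss lam b s)
    (hR.mono fun s hs => hK s hs a b ha hb)
  simpa using h

theorem sum_Icc_one_eq_sum_range (f : ℕ → ℝ) (t : ℕ) :
    ∑ τ ∈ Finset.Icc 1 t, f τ = ∑ τ ∈ Finset.range t, f (τ + 1) := by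
  rw [Finset.range_eq_Ico, Finset.sum_Ico_add' f 0 t 1]
  rfl

/-- As the weights are normalised, `F - F_mod^(t)` is a weighted empirical process. -/
theorem expLoss_sub_modEmpLoss (P : Measure (Signal N)) (p : ℝ) (s : ℕ → Signal N) {t : ℕ}
    (ht : 1 ≤ t) (d : Dictionary M L) :
    expLoss lam P d - modEmpLoss lam p s t d =
      ∑ τ ∈ Finset.range t, (1 / weightSum p t * (((τ + 1 : ℕ) : ℝ) / t) ^ p) *
        (∫ x, dictLoss lam d x ∂P - dictLoss lam d (s (τ + 1))) := by
  have h1 : ∑ τ ∈ Finset.range t, (1 / weightSum p t * (((τ + 1 : ℕ) : ℝ) / t) ^ p) = 1 := by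
    rw [← Finset.mul_sum, ← sum_Icc_one_eq_sum_range fun τ => ((τ : ℝ) / t) ^ p]
    exact one_div_mul_cancel (weightSum_pos ht).ne'
  simp only [mul_sub, Finset.sum_sub_distrib]
  rw [← Finset.sum_mul, h1, one_mul, modEmpLoss,
    sum_Icc_one_eq_sum_range fun τ => ((τ : ℝ) / t) ^ p * dictLoss lam d (s τ), Finset.mul_sum]
  simp only [mul_assoc, expLoss]

theorem aemeasurable_supNorm_sub (hlam : 0 < lam) {P : Measure (Signal N)}
    [IsProbabilityMeasure P] {R : ℝ} (hR : ∀ᵐ s ∂P, ‖s‖ ≤ R)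
    {Ω : Type*} [MeasurableSpace Ω] {μ : Measure Ω} {s : ℕ → Ω → Signal N}
    (hlaw : ∀ τ, 1 ≤ τ → HasLaw (s τ) P μ) (p : ℝ) (t : ℕ) :
    AEMeasurable (fun ω => supNorm fun d : Dictionary M L =>
      expLoss lam P d - modEmpLoss lam p (fun τ => s τ ω) t d) μ := by
  have hC : constraintSet M L ⊆ Metric.closedBall 0 2 := by
    rw [constraintSet_eq_closedBall]
    exact Metric.closedBall_subset_closedBall (by norm_num)
  refine aemeasurable_biSup_enorm (C := constraintSet M L) ⟨0, fun m => by simp⟩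
    (fun d => ?_) fun ω => ?_
  · refine aemeasurable_const.sub ((Finset.aemeasurable_fun_sum _ fun τ hτ => ?_).const_mul _)
    exact ((measurable_dictLoss hlam d).comp_aemeasurable
      (hlaw τ (Finset.mem_Icc.1 hτ).1).aemeasurable).const_mul _
  · refine ((continuousOn_expLoss hlam hR).mono hC).sub (continuousOn_const.mul ?_)
    exact continuousOn_finsetSum _ fun τ _ =>
      continuousOn_const.mul ((continuousOn_dictLoss hlam _).mono hC)

theorem exists_lintegral_supNorm_le (hlam : 0 < lam) {P : Measure (Signal N)}
    [IsProbabilityMeasure P] {R : ℝ} (hR : ∀ᵐ s ∂P, ‖s‖ ≤ R) {Ω : Type*} [MeasurableSpace Ω]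
    {μ : Measure Ω} [IsProbabilityMeasure μ] {s : ℕ → Ω → Signal N}
    (hlaw : ∀ τ, 1 ≤ τ → HasLaw (s τ) P μ) (hindep : iIndepFun (fun τ : ℕ => s (τ + 1)) μ) :
    ∃ B : ℝ, 0 < B ∧ ∀ t : ℕ, 1 ≤ t → ∀ p : ℝ, 0 ≤ p →
      ∫⁻ ω, ENNReal.ofReal (√(t : ℝ)) * supNorm (fun d : Dictionary M L =>
          expLoss lam P d - modEmpLoss lam p (fun τ => s τ ω) t d) ∂μ
        ≤ ENNReal.ofReal ((p + 1) / √(2 * p + 1) * B) := by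
  obtain ⟨K, hK, hlip⟩ := exists_dictLoss_lipschitz (N := N) (M := M) (L := L) hlam R
  obtain ⟨B, hB, hbound⟩ := exists_lintegral_iSup_le (Q := P)
    (h := fun (d : Dictionary M L) x => dictLoss lam d x) (K := max K (R ^ 2 / 2))
    (measurable_dictLoss hlam) (continuousOn_dictLoss hlam) (continuousOn_expLoss hlam hR)
    (fun d _ => integrable_dictLoss hlam hR d) (lt_max_of_lt_left hK)
    (hR.mono fun x hx a b ha hb => (hlip x hx a b ha hb).trans
      (mul_le_mul_of_nonneg_right (le_max_left _ _) (norm_nonneg _)))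
    (hR.mono fun x hx => (abs_dictLoss_le hlam hx 0).trans (le_max_right _ _))
  refine ⟨2 * B, by positivity, ?_⟩
  intro t ht p hp
  have hm := aemeasurable_supNorm_sub (M := M) (L := L) hlam hR hlaw p t
  have ht0 : 0 < √(t : ℝ) := Real.sqrt_pos.2 (by exact_mod_cast ht)
  have hp0 : 0 < √(2 * p + 1) := Real.sqrt_pos.2 (by linarith)
  have hw := sum_sq_weights_le hp ht
  rw [sum_Icc_one_eq_sum_range] at hw
  have h := hbound μ (Finset.range t) (fun τ => s (τ + 1))
    (fun τ => hlaw (τ + 1) (by omega)) hindep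
    (fun τ => 1 / weightSum p t * (((τ + 1 : ℕ) : ℝ) / t) ^ p) _ (by positivity) hw
  rw [lintegral_const_mul'' _ hm]
  simp only [supNorm, expLoss_sub_modEmpLoss P p _ ht, constraintSet_eq_closedBall]
  refine (mul_le_mul_right h _).trans_eq ?_
  rw [← ENNReal.ofReal_mul ht0.le]
  congr 1
  field_simp

end Law

end OnlineCDL

theorem proposition4p2 {N M L : ℕ} [NeZero N] {lam : ℝ} (hlam : 0 < lam)
    (P : Measure (OnlineCDL.Signal N)) [IsProbabilityMeasure P] (hP : IsCompact P.support)
    {Ω : Type*} [MeasurableSpace Ω] (μ : Measure Ω) [IsProbabilityMeasure μ]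
    (s : ℕ → Ω → OnlineCDL.Signal N)
    (hlaw : ∀ τ, 1 ≤ τ → HasLaw (s τ) P μ)
    (hindep : iIndepFun (fun τ : ℕ => s (τ + 1)) μ) :
    (∀ d ∈ OnlineCDL.constraintSet M L,
      Integrable (fun x : OnlineCDL.Signal N => OnlineCDL.dictLoss lam d x) P) ∧
    ∃ B : ℝ, 0 < B ∧ ∀ t : ℕ, 1 ≤ t →
      (AEMeasurable (fun ω => OnlineCDL.supNorm fun d : OnlineCDL.Dictionary M L =>
          OnlineCDL.expLoss lam P d - OnlineCDL.empLoss lam (fun τ => s τ ω) t d) μ ∧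
        ∫⁻ ω, ENNReal.ofReal (√(t : ℝ)) *
          OnlineCDL.supNorm (fun d : OnlineCDL.Dictionary M L =>
            OnlineCDL.expLoss lam P d - OnlineCDL.empLoss lam (fun τ => s τ ω) t d) ∂μ
          ≤ ENNReal.ofReal B) ∧
      ∀ p : ℝ, 0 ≤ p →
        AEMeasurable (fun ω => OnlineCDL.supNorm fun d : OnlineCDL.Dictionary M L =>
          OnlineCDL.expLoss lam P d - OnlineCDL.modEmpLoss lam p (fun τ => s τ ω) t d) μ ∧
        ∫⁻ ω, ENNReal.ofReal (√(t : ℝ)) *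
          OnlineCDL.supNorm (fun d : OnlineCDL.Dictionary M L =>
            OnlineCDL.expLoss lam P d - OnlineCDL.modEmpLoss lam p (fun τ => s τ ω) t d) ∂μ
          ≤ ENNReal.ofReal ((p + 1) / √(2 * p + 1) * B) := by
  obtain ⟨R, hR⟩ := OnlineCDL.exists_ae_norm_le P hP
  obtain ⟨B, hB, hbound⟩ :=
    OnlineCDL.exists_lintegral_supNorm_le (M := M) (L := L) hlam hR hlaw hindep
  have hmeas := OnlineCDL.aemeasurable_supNorm_sub (M := M) (L := L) hlam hR hlaw
  refine ⟨fun d _ => OnlineCDL.integrable_dictLoss hlam hR d, B, hB, fun t ht =>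
    ⟨?_, fun p hp => ⟨hmeas p t, hbound t ht p hp⟩⟩⟩
  -- The plain average is the case `p = 0`, where the factor `(p + 1) / √(2 p + 1)` equals `1`.
  simp only [OnlineCDL.empLoss_eq_modEmpLoss]
  exact ⟨hmeas 0 t, by simpa using hbound t ht 0 le_rfl⟩
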